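/- Let $d\ge 1$ be an integer and let $|0\rangle,\dots,|d-1\rangle$ be the standard basis of $\mathbb{C}^d$. Put $s=(d-1)/2$ and $m_k=s-k$ for $0\le k\le d-1$. For $0\le L\le 2s=d-1$ and $-L\le M\le L$ let $$T_{LM}=\sqrt{\frac{2L+1}{2s+1}}\sum_{k,l=0}^{d-1}C^{s\,m_k}_{s\,m_l,\,L M}\,|k\rangle\langle l|$$ be the polarization operators, where $C^{j m}_{j_1m_1,\,j_2m_2}$ are the Clebsch--Gordan coefficients (Condon--Shortley phase convention), and set $$T=\sum_{(L,M)\neq(0,0)}T_{LM}\otimes T_{LM}.$$ Let $$|\phi_+\rangle=\frac1{\sqrt d}\sum_{j}|j\rangle\otimes|j\rangle,\qquad \rho_\alpha=\alpha\,|\phi_+\rangle\langle\phi_+|+\frac{1-\alpha}{d^2}\,\mathbb 1 .$$ With $\Lambda_s^{jk}=|j\rangle\langle k|+|k\rangle\langle j|$ and $\Lambda_a^{jk}=-i|j\rangle\langle k|+i|k\rangle\langle j|$ for $j<k$, and $\Lambda^l=\sqrt{\tfrac{2}{l(l+1)}}\bigl(\sum_{j=0}^{l-1}|j\rangle\langle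 j|-l\,|l\rangle\langle l|\bigr)$ for $1\le l\le d-1$ (the generalized Gell-Mann matrices), let $$\Lambda=\sum_{j<k}\Lambda_s^{jk}\otimes\Lambda_s^{jk}-\sum_{j<k}\Lambda_a^{jk}\otimes\Lambda_a^{jk}+\sum_{l=1}^{d-1}\Lambda^l\otimes\Lambda^l .$$ With the Weyl operators $U_{nm}=\sum_{k=0}^{d-1}e^{2\pi i kn/d}\,|k\rangle\langle (k+m)\bmod d|$, $0\le n,m\le d-1$, let $$U=\sum_{\substack{0\le l,m\le d-1\\(l,m)\ne(0,0)}}U_{lm}\otimes U_{-l\,m},$$ where $-l$ is taken modulo $d$. Then $$|\phi_+\rangle\langle\phi_+|=\frac1d\sum_{L=0}^{d-1}\sum_{M=-L}^{L}T_{LM}\otimes T_{LM}=\frac1{d^2}\,\mathbb 1\otimes\mathbb 1+\frac1d\,T,$$ $$\rho_\alpha=\frac1{d^2}\,\mathbb 1\otimes\mathbb 1+\frac{\alpha}{d}\,T\qquad\text{for every real }\alpha$$ (in particular for $-\frac1{d^2-1}\le\alpha\le1$ with $d\ge2$, where $\rho_\alpha$ is the isotropic two-qudit state), and $$\Lambda=2T,\qquad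 T=\frac1d\,U .$$ -/

import Mathlib

open scoped Kronecker

noncomputable section

namespace Qudit

/-! ### Clebsch–Gordan coefficients -/

/-- `q!` for a rational `q` that is a natural number (only used for such `q`). -/
def fact (q : ℚ) : ℝ := (Nat.factorial ⌊q⌋₊ : ℝ)

/-- `1 / q!` for an integral rational `q`, with the convention `1 / q! = 0` for `q < 0`. -/
def invFact (q : ℚ) : ℝ := if q < 0 then 0 else (fact q)⁻¹

/-- `j` is a spin (`2 j` is a natural number) and `m` is one of `-j, -j + 1, …, j`. -/
def IsWeight (j m : ℚ) : Prop := (∃ a : ℕ, j + m = a) ∧ (∃ b : ℕ, j - m = b)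

/-- The triangle condition: `|j₁ - j₂| ≤ j ≤ j₁ + j₂` in integer steps. -/
def IsTriangle (j₁ j₂ j : ℚ) : Prop :=
  (∃ a : ℕ, j₁ + j₂ - j = a) ∧ (∃ b : ℕ, j₁ - j₂ + j = b) ∧ (∃ c : ℕ, -j₁ + j₂ + j = c)

open Classical in
/-- The Clebsch–Gordan coefficient `C^{j m}_{j₁ m₁, j₂ m₂} = ⟨j₁ m₁ j₂ m₂ | j m⟩` of angular
momentum theory (Condon–Shortley phases), by Racah's explicit formula. It vanishes unless the
angular momenta and their projections are admissible, the triangle condition holds, and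
`m = m₁ + m₂`. The sum runs over all integers `t` for which every factorial in the denominator
has a nonnegative argument. -/
def clebschGordan (j₁ m₁ j₂ m₂ j m : ℚ) : ℝ :=
  if IsWeight j₁ m₁ ∧ IsWeight j₂ m₂ ∧ IsWeight j m ∧ IsTriangle j₁ j₂ j ∧ m = m₁ + m₂ then
    √((2 * (j : ℝ) + 1) * fact (j₁ + j₂ - j) * fact (j₁ - j₂ + j) * fact (-j₁ + j₂ + j)
        / fact (j₁ + j₂ + j + 1)) *
    √(fact (j₁ + m₁) * fact (j₁ - m₁) * fact (j₂ + m₂) * fact (j₂ - m₂)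
        * fact (j + m) * fact (j - m)) *
    ∑ t ∈ Finset.range (⌊j₁ + j₂ - j⌋₊ + 1),
      (-1 : ℝ) ^ t * invFact t * invFact (j₁ + j₂ - j - t) * invFact (j₁ - m₁ - t)
        * invFact (j₂ + m₂ - t) * invFact (j - j₂ + m₁ + t) * invFact (j - j₁ - m₂ + t)
  else 0

/-! ### Matrix bases. The standard basis of `ℂ^d` is indexed by `0, …, d - 1`. -/

/-- The operator `|j⟩⟨k|`. -/
def ketBra {d : ℕ} (j k : Fin d) : Matrix (Fin d) (Fin d) ℂ := Matrix.single j k 1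

/-- The spin `s = (d - 1) / 2`. -/
def spin (d : ℕ) : ℚ := ((d : ℚ) - 1) / 2

/-- The magnetic quantum numbers `s, s - 1, …, -s`, in this order. -/
def mag (d : ℕ) (k : Fin d) : ℚ := spin d - (k : ℕ)

/-- The polarization operator
`T_{LM} = √((2L+1)/(2s+1)) ∑_{k,l} C^{s m_k}_{s m_l, L M} |k⟩⟨l|`. -/
def polarizationOp (d L : ℕ) (M : ℤ) : Matrix (Fin d) (Fin d) ℂ :=
  ((√((2 * (L : ℝ) + 1) / (2 * (spin d : ℝ) + 1)) : ℝ) : ℂ) •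
    ∑ k : Fin d, ∑ l : Fin d,
      ((clebschGordan (spin d) (mag d l) L M (spin d) (mag d k) : ℝ) : ℂ) • ketBra k l

/-- `T = ∑_{(L,M) ≠ (0,0)} T_{LM} ⊗ T_{LM}`, with `L = 0, …, 2s = d - 1`, `M = -L, …, L`. -/
def opT (d : ℕ) : Matrix (Fin d × Fin d) (Fin d × Fin d) ℂ :=
  ∑ L ∈ Finset.range d, ∑ M ∈ (Finset.Icc (-(L : ℤ)) L).filter (fun M => (L, M) ≠ (0, 0)),
    polarizationOp d L M ⊗ₖ polarizationOp d L M

/-- The symmetric generalized Gell-Mann matrix `|j⟩⟨k| + |k⟩⟨j|`. -/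
def gellMannSymm {d : ℕ} (j k : Fin d) : Matrix (Fin d) (Fin d) ℂ :=
  ketBra j k + ketBra k j

/-- The antisymmetric generalized Gell-Mann matrix `-i |j⟩⟨k| + i |k⟩⟨j|`. -/
def gellMannAnti {d : ℕ} (j k : Fin d) : Matrix (Fin d) (Fin d) ℂ :=
  (-Complex.I) • ketBra j k + Complex.I • ketBra k j

/-- The diagonal generalized Gell-Mann matrix
`√(2/(l(l+1))) (∑_{j=1}^{l} |j⟩⟨j| - l |l+1⟩⟨l+1|)`, `1 ≤ l ≤ d - 1`;
the `j`-th basis vector in this count has index `j - 1`. -/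
def gellMannDiag (d l : ℕ) : Matrix (Fin d) (Fin d) ℂ :=
  ((√(2 / ((l : ℝ) * (l + 1))) : ℝ) : ℂ) •
    Matrix.diagonal (fun i : Fin d =>
      if (i : ℕ) < l then 1 else if (i : ℕ) = l then -(l : ℂ) else 0)

/-- `Λ = ∑_{j<k} Λ_s^{jk} ⊗ Λ_s^{jk} - ∑_{j<k} Λ_a^{jk} ⊗ Λ_a^{jk} + ∑_{l=1}^{d-1} Λ^l ⊗ Λ^l`. -/
def opLambda (d : ℕ) : Matrix (Fin d × Fin d) (Fin d × Fin d) ℂ :=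
  (∑ j : Fin d, ∑ k ∈ Finset.univ.filter (fun k => j < k), gellMannSymm j k ⊗ₖ gellMannSymm j k)
  - (∑ j : Fin d, ∑ k ∈ Finset.univ.filter (fun k => j < k),
      gellMannAnti j k ⊗ₖ gellMannAnti j k)
  + ∑ l ∈ Finset.Icc 1 (d - 1), gellMannDiag d l ⊗ₖ gellMannDiag d l

/-- The Weyl operator `U_{nm} = ∑_k e^{2πi k n / d} |k⟩⟨(k + m) mod d|`. -/
def weylOp (d n m : ℕ) : Matrix (Fin d) (Fin d) ℂ :=
  ∑ k : Fin d, Complex.exp (2 * Real.pi * Complex.I / d * ((k : ℕ) * n)) •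
    ketBra k ⟨((k : ℕ) + m) % d, Nat.mod_lt _ k.pos⟩

/-- `U = ∑_{(l,m) ≠ (0,0)} U_{lm} ⊗ U_{-l m}`, with `l, m = 0, …, d - 1` and `-l` taken
modulo `d`. -/
def opU (d : ℕ) : Matrix (Fin d × Fin d) (Fin d × Fin d) ℂ :=
  ∑ l ∈ Finset.range d, ∑ m ∈ (Finset.range d).filter (fun m => (l, m) ≠ (0, 0)),
    weylOp d l m ⊗ₖ weylOp d ((d - l) % d) m

/-! ### States -/

/-- The Bell vector `|φ₊⟩ = (1/√d) ∑_j |j⟩ ⊗ |j⟩`. -/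
def bellKet (d : ℕ) : Fin d × Fin d → ℂ :=
  ((1 / √(d : ℝ) : ℝ) : ℂ) •
    ∑ j : Fin d, fun p => (Pi.single j 1 : Fin d → ℂ) p.1 * (Pi.single j 1 : Fin d → ℂ) p.2

/-- The Bell state `|φ₊⟩⟨φ₊|`. -/
def bellState (d : ℕ) : Matrix (Fin d × Fin d) (Fin d × Fin d) ℂ :=
  Matrix.vecMulVec (bellKet d) (star (bellKet d))

/-- The isotropic two-qudit state `ρ_α = α |φ₊⟩⟨φ₊| + ((1 - α)/d²) 𝟙`. -/
def isotropicState (d : ℕ) (α : ℝ) : Matrix (Fin d × Fin d) (Fin d × Fin d) ℂ :=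
  (α : ℂ) • bellState d + ((1 - α : ℂ) / (d : ℂ) ^ 2) • 1

end Qudit

end

namespace Qudit

/-! ### Coefficients of `(1 - x)^L (1 + y)^L (1 + x y)^n` -/

/-! All the identities follow from one fact: $\sum_{L,M}T_{LM}\otimes T_{LM}$ has entry $1$ at
$((a,a),(c,c))$ and $0$ elsewhere, so it equals $d\,|\phi_+\rangle\langle\phi_+|$. Splitting off
$T_{00}\otimes T_{00}=\frac1d\mathbb 1$ gives the entries of $T$ (`opT_apply`), with which $\Lambda$
and $U$ are compared entry by entry.

That fact is the completeness of the $T_{LM}$. There are $d^2$ of them with real entries, so it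
follows from orthonormality: a square $A$ with $AA^{T}=1$ also has $A^{T}A=1$.

For orthonormality put $N=d-1=L+n$. By Racah's formula the entry $(k,l)$ of $T_{LM}$ is supported on
$l-k=M$ and there is a constant times $\sqrt{k!(N-k)!\,l!(N-l)!}$ times the coefficient of $x^ly^k$
in $(1-x)^L(1+y)^L(1+xy)^n$ (`clebschGordan_eq_coupling`). In the pairing with these weights,
multiplication by $q=x_1y_1+x_2y_2$ (that is, $1+xy$ homogenized) is adjoint to
$\Delta=\partial_{x_1}\partial_{y_1}+\partial_{x_2}\partial_{y_2}$ (`pairing_shift`), and $\Delta$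
kills $(x_2-x_1)^L(y_1+y_2)^L$. So different $L$ are orthogonal, and norms reduce to $n=0$, a
Vandermonde sum. -/

/-- The binomial coefficient `L.choose k`, extended by zero to negative `k`. -/
noncomputable def intChoose (L : ℕ) (k : ℤ) : ℝ := if 0 ≤ k then (L.choose k.toNat : ℝ) else 0

/-- The coefficient of `x ^ k` in `(1 - x) ^ L`. -/
noncomputable def altChoose (L : ℕ) (k : ℤ) : ℝ := if 0 ≤ k then (-1) ^ k.toNat * (L.choose k.toNat : ℝ) else 0

/-- The coefficient of `x ^ l * y ^ k` in `(1 - x) ^ L * (1 + y) ^ L * (1 + x * y) ^ n`. -/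
noncomputable def coupling (L : ℕ) : ℕ → ℤ → ℤ → ℝ
  | 0, k, l => intChoose L k * altChoose L l
  | n + 1, k, l => coupling L n k l + coupling L n (k - 1) (l - 1)

theorem intChoose_natCast (L k : ℕ) : intChoose L k = L.choose k := by simp [intChoose]

theorem altChoose_natCast (L k : ℕ) : altChoose L k = (-1) ^ k * L.choose k := by simp [altChoose]

theorem intChoose_of_neg {L : ℕ} {k : ℤ} (h : k < 0) : intChoose L k = 0 := by
  simp [intChoose, h]

theorem altChoose_of_neg {L : ℕ} {k : ℤ} (h : k < 0) : altChoose L k = 0 := by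
  simp [altChoose, h]

theorem intChoose_of_lt {L : ℕ} {k : ℤ} (h : (L : ℤ) < k) : intChoose L k = 0 := by
  lift k to ℕ using by omega
  rw [intChoose_natCast, Nat.choose_eq_zero_of_lt (by omega), Nat.cast_zero]

theorem altChoose_of_lt {L : ℕ} {k : ℤ} (h : (L : ℤ) < k) : altChoose L k = 0 := by
  lift k to ℕ using by omega
  rw [altChoose_natCast, Nat.choose_eq_zero_of_lt (by omega), Nat.cast_zero, mul_zero]

theorem choose_succ_mul_cast (L k : ℕ) :
    ((k : ℝ) + 1) * (L.choose (k + 1) : ℝ) = ((L : ℝ) - k) * L.choose k := by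
  rcases le_or_gt k L with h | h
  · have := Nat.choose_succ_right_eq L k
    rw [← Nat.cast_sub h]
    exact_mod_cast (by linarith : (k + 1) * L.choose (k + 1) = (L - k) * L.choose k)
  · simp [Nat.choose_eq_zero_of_lt h, Nat.choose_eq_zero_of_lt (Nat.lt_succ_of_lt h)]

/-- The equation $(1+y)f'=Lf$ for $f=(1+y)^L$, read off coefficientwise. -/
theorem intChoose_succ_mul (L : ℕ) (k : ℤ) :
    ((k : ℝ) + 1) * intChoose L (k + 1) = ((L : ℝ) - k) * intChoose L k := by
  rcases lt_trichotomy k (-1) with h | rfl | h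
  · rw [intChoose_of_neg (by omega), intChoose_of_neg (by omega)]; simp
  · simp [intChoose_of_neg]
  · lift k to ℕ using by omega
    have := choose_succ_mul_cast L k
    rw [← Nat.cast_succ, intChoose_natCast, intChoose_natCast]
    exact_mod_cast this

theorem altChoose_succ_mul (L : ℕ) (k : ℤ) :
    ((k : ℝ) + 1) * altChoose L (k + 1) = -(((L : ℝ) - k) * altChoose L k) := by
  rcases lt_trichotomy k (-1) with h | rfl | h
  · rw [altChoose_of_neg (by omega), altChoose_of_neg (by omega)]; simp
  · simp [altChoose_of_neg]
  · lift k to ℕ using by omega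
    have := choose_succ_mul_cast L k
    rw [← Nat.cast_succ, altChoose_natCast, altChoose_natCast, pow_succ]
    push_cast
    linear_combination (-(-1) ^ k) * this

theorem coupling_eq_zero (L n : ℕ) {k l : ℤ}
    (h : k < 0 ∨ l < 0 ∨ (L + n : ℤ) < k ∨ (L + n : ℤ) < l) : coupling L n k l = 0 := by
  induction n generalizing k l with
  | zero =>
    rw [coupling]
    rcases h with h | h | h | h
    · rw [intChoose_of_neg h, zero_mul]
    · rw [altChoose_of_neg h, mul_zero]
    · rw [intChoose_of_lt (by simpa using h), zero_mul]
    · rw [altChoose_of_lt (by simpa using h), mul_zero]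
  | succ n ih =>
    rw [coupling, ih (by push_cast at h; omega), ih (by push_cast at h; omega), add_zero]

theorem coupling_eq_sum (L n : ℕ) (k l : ℤ) :
    coupling L n k l =
      ∑ r ∈ Finset.range (n + 1), (n.choose r : ℝ) * (intChoose L (k - r) * altChoose L (l - r)) := by
  induction n generalizing k l with
  | zero => simp [coupling]
  | succ n ih =>
    rw [coupling, ih, ih,
      Finset.sum_choose_succ_mul (fun r _ => intChoose L (k - r) * altChoose L (l - r))]
    congr 1
    · refine Finset.sum_congr rfl fun r _ => ?_
      push_cast
      rw [sub_sub, sub_sub, add_comm (1 : ℤ)]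

/-- The contraction `∂_{x₁} ∂_{y₁} + ∂_{x₂} ∂_{y₂}`, on the coefficients of a bihomogeneous
polynomial of bidegree `(N, N)`. -/
noncomputable def contraction (N : ℕ) (g : ℤ → ℤ → ℝ) (k l : ℤ) : ℝ :=
  (k + 1) * (l + 1) * g (k + 1) (l + 1) + (N - k) * (N - l) * g k l

/-- On $(x_2-x_1)^L(y_1+y_2)^L$ the two mixed derivatives are opposite. -/
theorem contraction_coupling_zero (L : ℕ) (k l : ℤ) :
    contraction L (coupling L 0) k l = 0 := by
  simp only [contraction, coupling]
  linear_combination (l + 1) * altChoose L (l + 1) * intChoose_succ_mul L k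
    + (L - k) * intChoose L k * altChoose_succ_mul L l

/-- On bidegree $(D,D)$ one has $\Delta q=q\Delta+(2D+2)$; summing $2(L+j)+2$ over $0\le j\le n$
gives the constant. -/
theorem contraction_coupling_succ (L n : ℕ) (k l : ℤ) :
    contraction (L + (n + 1)) (coupling L (n + 1)) k l =
      (n + 1) * (n + 2 + 2 * L) * coupling L n k l := by
  induction n generalizing k l with
  | zero =>
    have h1 := contraction_coupling_zero L k l
    have h2 := contraction_coupling_zero L (k - 1) (l - 1)
    simp only [contraction, coupling, sub_add_cancel, add_sub_cancel_right] at *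
    push_cast at *
    linear_combination h1 + h2
  | succ n ih =>
    have h1 := ih k l
    have h2 := ih (k - 1) (l - 1)
    have h3 : ∀ i j, coupling L (n + 1 + 1) i j =
      coupling L (n + 1) i j + coupling L (n + 1) (i - 1) (j - 1) := fun _ _ => rfl
    have h4 : coupling L (n + 1) k l = coupling L n k l + coupling L n (k - 1) (l - 1) := rfl
    simp only [contraction, sub_add_cancel, h3, add_sub_cancel_right] at *
    push_cast at *
    linear_combination h1 + h2 - (n + 1) * (n + 2 + 2 * L) * h4

theorem contraction_coupling_succ_eq (L n : ℕ) :
    contraction (L + (n + 1)) (coupling L (n + 1)) =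
      fun k l => (n + 1) * (n + 2 + 2 * L) * coupling L n k l :=
  funext fun k => funext fun l => contraction_coupling_succ L n k l

/-! ### The weighted pairing -/

/-- The weight `k! (N - k)!`. -/
noncomputable def binomWeight (N k : ℕ) : ℝ := k.factorial * (N - k).factorial

theorem binomWeight_pos (N k : ℕ) : 0 < binomWeight N k := by unfold binomWeight; positivity

theorem binomWeight_succ_left {N k : ℕ} (h : k ≤ N) :
    binomWeight (N + 1) k = (N + 1 - k) * binomWeight N k := by
  rw [binomWeight, binomWeight, Nat.succ_sub h, Nat.factorial_succ]
  push_cast [h]; ring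

theorem binomWeight_succ_succ (N k : ℕ) :
    binomWeight (N + 1) (k + 1) = (k + 1) * binomWeight N k := by
  rw [binomWeight, binomWeight, Nat.add_sub_add_right, Nat.factorial_succ]
  push_cast; ring

/-- The pairing of coefficient arrays with weight `k! (N - k)! l! (N - l)!`, further weighted by a
function of `l - k`. -/
noncomputable def pairing (N : ℕ) (φ : ℤ → ℝ) (f g : ℤ → ℤ → ℝ) : ℝ :=
  ∑ k ∈ Finset.range (N + 1), ∑ l ∈ Finset.range (N + 1),
    φ (l - k) * (binomWeight N k * binomWeight N l) * (f k l * g k l)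

/-- The factorial weights make multiplication by a variable adjoint to its derivative. The shift
moves $k$ and $l$ together, so `φ (l - k)` plays no role. -/
theorem pairing_shift (N : ℕ) (φ : ℤ → ℝ) (f g : ℤ → ℤ → ℝ)
    (hf : ∀ k l, k < 0 ∨ l < 0 ∨ (N : ℤ) < k ∨ (N : ℤ) < l → f k l = 0) :
    pairing (N + 1) φ (fun k l => f k l + f (k - 1) (l - 1)) g =
      pairing N φ f (contraction (N + 1) g) := by
  have h1 : ∑ k ∈ Finset.range (N + 2), ∑ l ∈ Finset.range (N + 2),
      φ (l - k) * (binomWeight (N + 1) k * binomWeight (N + 1) l) * (f k l * g k l) =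
      ∑ k ∈ Finset.range (N + 1), ∑ l ∈ Finset.range (N + 1),
        φ (l - k) * (binomWeight N k * binomWeight N l) *
          (f k l * ((N + 1 - k) * (N + 1 - l) * g k l)) := by
    -- The row and column with index $N+1$ lie outside the support of `f`; in `h2` the index $0$
    -- drops out instead.
    rw [Finset.sum_range_succ, Finset.sum_eq_zero (s := Finset.range (N + 2)), add_zero]
    · refine Finset.sum_congr rfl fun k hk => ?_
      rw [Finset.sum_range_succ, hf k (N + 1 : ℕ) (by push_cast; omega)]
      rw [zero_mul, mul_zero, add_zero]
      refine Finset.sum_congr rfl fun l hl => ?_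
      rw [Finset.mem_range] at hk hl
      rw [binomWeight_succ_left (by omega), binomWeight_succ_left (by omega)]
      ring
    · intro l _
      rw [hf (N + 1 : ℕ) l (by push_cast; omega), zero_mul, mul_zero]
  have h2 : ∑ k ∈ Finset.range (N + 2), ∑ l ∈ Finset.range (N + 2),
      φ (l - k) * (binomWeight (N + 1) k * binomWeight (N + 1) l) * (f (k - 1) (l - 1) * g k l) =
      ∑ k ∈ Finset.range (N + 1), ∑ l ∈ Finset.range (N + 1),
        φ (l - k) * (binomWeight N k * binomWeight N l) *
          (f k l * ((k + 1) * (l + 1) * g (k + 1) (l + 1))) := by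
    rw [Finset.sum_range_succ', Finset.sum_eq_zero (s := Finset.range (N + 2)), add_zero]
    · refine Finset.sum_congr rfl fun k hk => ?_
      rw [Finset.sum_range_succ', hf _ ((0 : ℕ) - 1) (by omega)]
      rw [zero_mul, mul_zero, add_zero]
      refine Finset.sum_congr rfl fun l hl => ?_
      rw [binomWeight_succ_succ, binomWeight_succ_succ]
      push_cast
      rw [add_sub_add_right_eq_sub, add_sub_cancel_right, add_sub_cancel_right]
      ring
    · intro l _
      rw [hf ((0 : ℕ) - 1) _ (by omega), zero_mul, mul_zero]
  calc _ = _ + _ := by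
        simp only [pairing, add_mul, mul_add (φ _ * _), Finset.sum_add_distrib]
    _ = _ + _ := congrArg₂ _ h1 h2
    _ = _ := by
        simp only [pairing, contraction, ← Finset.sum_add_distrib]
        refine Finset.sum_congr rfl fun k _ => Finset.sum_congr rfl fun l _ => ?_
        push_cast
        ring

theorem pairing_coupling_succ (L n : ℕ) (φ : ℤ → ℝ) (g : ℤ → ℤ → ℝ) :
    pairing (L + (n + 1)) φ (coupling L (n + 1)) g =
      pairing (L + n) φ (coupling L n) (contraction (L + (n + 1)) g) :=
  pairing_shift (L + n) φ (coupling L n) g fun _ _ h => coupling_eq_zero L n (by push_cast at h; omega)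

theorem pairing_const_mul_right (N : ℕ) (φ : ℤ → ℝ) (f g : ℤ → ℤ → ℝ) (c : ℝ) :
    pairing N φ f (fun k l => c * g k l) = c * pairing N φ f g := by
  simp only [pairing, Finset.mul_sum]
  refine Finset.sum_congr rfl fun k _ => Finset.sum_congr rfl fun l _ => by ring

theorem pairing_comm (N : ℕ) (φ : ℤ → ℝ) (f g : ℤ → ℤ → ℝ) :
    pairing N φ f g = pairing N φ g f := by
  simp only [pairing, mul_comm (f _ _)]

/-- Each factor $q$ moved from the left acts as $\Delta$ on the right and removes a $q$ there. The
left has $p+1$ more factors, so $\Delta$ finally meets a polynomial that it kills. -/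
theorem pairing_coupling_of_lt (p L n : ℕ) (φ : ℤ → ℝ) :
    pairing (L + (p + 1) + n) φ (coupling L (p + n + 1)) (coupling (L + (p + 1)) n) = 0 := by
  induction n with
  | zero =>
    rw [add_zero, add_zero, pairing_coupling_succ,
      -- The zero array is written as a multiple so that `pairing_const_mul_right` applies.
      show contraction (L + (p + 1)) _ = fun _ _ => (0 : ℝ) * 0 from
        funext fun k => funext fun l => by rw [contraction_coupling_zero]; simp,
      pairing_const_mul_right, zero_mul]
  | succ n ih =>
    have e : L + (p + 1) + (n + 1) = L + (p + n + 1 + 1) := by omega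
    rw [← add_assoc p, e, pairing_coupling_succ, ← e,
      contraction_coupling_succ_eq,
      pairing_const_mul_right, show L + (p + n + 1) = L + (p + 1) + n by omega, ih, mul_zero]

/-- The arrays `coupling L` with different `L` are orthogonal. -/
theorem pairing_coupling_of_ne {L L' n n' : ℕ} (h : L + n = L' + n') (hne : L ≠ L') (φ : ℤ → ℝ) :
    pairing (L + n) φ (coupling L n) (coupling L' n') = 0 := by
  wlog hlt : L < L' generalizing L L' n n'
  · rw [h, pairing_comm]
    exact this h.symm hne.symm (by omega)
  obtain ⟨p, rfl⟩ := Nat.exists_eq_add_of_lt hlt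
  obtain rfl : n = p + n' + 1 := by omega
  rw [h]
  exact pairing_coupling_of_lt p L n' φ

/-- The same adjunction yields the product of the constants $(j+1)(j+2+2L)$ for $j<n$. -/
theorem pairing_coupling_self (L n : ℕ) (φ : ℤ → ℝ) :
    (2 * L + 1).factorial * pairing (L + n) φ (coupling L n) (coupling L n) =
      n.factorial * (2 * L + 1 + n).factorial * pairing L φ (coupling L 0) (coupling L 0) := by
  induction n with
  | zero => simp
  | succ n ih =>
    rw [pairing_coupling_succ, contraction_coupling_succ_eq,
      pairing_const_mul_right, mul_left_comm, ih, ← add_assoc, Nat.factorial_succ,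
      Nat.factorial_succ]
    push_cast
    ring

/-- Vandermonde's identity after the reflection $\binom{L}{k+M}=\binom{L}{L-M-k}$. -/
theorem sum_choose_mul_choose_shift (L : ℕ) (M : ℤ) (h : |M| ≤ L) :
    ∑ k ∈ Finset.range (L + 1), ∑ l ∈ Finset.range (L + 1),
      (if (l - k : ℤ) = M then L.choose k * L.choose l else 0) = (2 * L).choose (L - M).toNat := by
  rw [two_mul, Nat.add_choose_eq, Finset.Nat.sum_antidiagonal_eq_sum_range_succ
    (fun i j => L.choose i * L.choose j)]
  have hM := abs_le.mp h
  have key : ∀ k ∈ Finset.range (2 * L + 1), ∑ l ∈ Finset.range (L + 1),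
      (if (l - k : ℤ) = M then L.choose k * L.choose l else 0) =
      if k ≤ (L - M).toNat then L.choose k * L.choose ((L - M).toNat - k) else 0 := by
    intro k hk
    split_ifs with hk'
    · by_cases hb : 0 ≤ k + M
      · rw [Finset.sum_eq_single (k + M).toNat]
        · rw [if_pos (by omega), ← Nat.choose_symm_of_eq_add
            (by omega : L = (k + M).toNat + ((L - M).toNat - k))]
        · intro l _ hl; rw [if_neg (by omega)]
        · intro hl; rw [Finset.mem_range] at hl; omega
      · rw [Nat.choose_eq_zero_of_lt (by omega : L < (L - M).toNat - k), mul_zero]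
        exact Finset.sum_eq_zero fun l _ => if_neg (by omega)
    · exact Finset.sum_eq_zero fun l hl => if_neg (by rw [Finset.mem_range] at hl; omega)
  have hz : ∀ b, L + 1 ≤ b → ∀ F : ℕ → ℕ, (∀ k, L < k → F k = 0) →
      ∑ k ∈ Finset.range (L + 1), F k = ∑ k ∈ Finset.range b, F k := fun b hb F hF =>
    Finset.sum_subset (Finset.range_mono hb) fun k _ hk => hF k (by simpa using hk)
  rw [hz (2 * L + 1) (by omega) _ fun k hk => Finset.sum_eq_zero fun l _ => by
    simp [Nat.choose_eq_zero_of_lt hk], Finset.sum_congr rfl key, ← Finset.sum_filter]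
  refine Finset.sum_congr ?_ fun _ _ => rfl
  ext k
  simp only [Finset.mem_filter, Finset.mem_range]
  omega

theorem binomWeight_mul_choose {L k : ℕ} (h : k ≤ L) :
    binomWeight L k * L.choose k = L.factorial := by
  rw [binomWeight, ← Nat.choose_mul_factorial_mul_factorial h]
  push_cast; ring

theorem pairing_coupling_zero (L : ℕ) (M : ℤ) (h : |M| ≤ L) :
    (L + M).toNat.factorial * (L - M).toNat.factorial *
      pairing L (fun m => if m = M then 1 else 0) (coupling L 0) (coupling L 0) =
      (L.factorial : ℝ) ^ 2 * (2 * L).factorial := by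
  have hM := abs_le.mp h
  have h1 : pairing L (fun m => if m = M then 1 else 0) (coupling L 0) (coupling L 0) =
      (L.factorial : ℝ) ^ 2 * (2 * L).choose (L - M).toNat := by
    rw [← sum_choose_mul_choose_shift L M h, pairing]
    push_cast
    simp only [Finset.mul_sum]
    refine Finset.sum_congr rfl fun k hk => Finset.sum_congr rfl fun l hl => ?_
    split_ifs
    · rw [coupling, intChoose_natCast, altChoose_natCast]
      have hk' := binomWeight_mul_choose (Nat.lt_succ_iff.mp (Finset.mem_range.mp hk))
      have hl' := binomWeight_mul_choose (Nat.lt_succ_iff.mp (Finset.mem_range.mp hl))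
      have hs : ((-1 : ℝ) ^ l) ^ 2 = 1 := by rw [← pow_mul, mul_comm, pow_mul]; simp
      linear_combination L.choose k * L.choose l * (binomWeight L k * L.choose k * hl' + L.factorial * hk')
        + binomWeight L k * binomWeight L l * (L.choose k * L.choose l) ^ 2 * hs
    · simp
  rw [h1]
  have h2 := Nat.choose_mul_factorial_mul_factorial (by omega : (L - M).toNat ≤ 2 * L)
  rw [show 2 * L - (L - M).toNat = (L + M).toNat by omega] at h2
  rw [← h2]
  push_cast; ring

/-- The squared norm of the part of `coupling L n` with `l - k = M`. -/
theorem pairing_coupling_indicator (L n : ℕ) (M : ℤ) (h : |M| ≤ L) :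
    (2 * L + 1) * ((L + M).toNat.factorial * (L - M).toNat.factorial) *
      pairing (L + n) (fun m => if m = M then 1 else 0) (coupling L n) (coupling L n) =
      (L.factorial : ℝ) ^ 2 * n.factorial * (2 * L + 1 + n).factorial := by
  have h1 := pairing_coupling_self L n (fun m => if m = M then 1 else 0)
  have h2 := pairing_coupling_zero L M h
  rw [Nat.factorial_succ] at h1
  push_cast at h1
  have h3 : ((2 * L).factorial : ℝ) ≠ 0 := by positivity
  apply mul_left_cancel₀ h3
  linear_combination ((L + M).toNat.factorial * (L - M).toNat.factorial) * h1
    + n.factorial * (2 * L + 1 + n).factorial * h2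

/-! ### Racah's formula in terms of `coupling` -/

theorem fact_natCast (a : ℕ) : fact a = a.factorial := by simp [fact]

theorem invFact_intCast (z : ℤ) : invFact z = if z < 0 then 0 else (z.toNat.factorial : ℝ)⁻¹ := by
  rw [invFact]
  simp only [Int.cast_lt_zero]
  split_ifs with h
  · rfl
  · lift z to ℕ using by omega
    rw [Int.cast_natCast, fact_natCast, Int.toNat_natCast]

/-- Pairs the six inverse factorials in Racah's sum into three binomial coefficients. -/
theorem invFact_mul_invFact (L : ℕ) (z : ℤ) :
    invFact z * invFact (L - z) = intChoose L z / L.factorial := by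
  rw [show ((L : ℚ) - z) = ((L - z : ℤ) : ℚ) by push_cast; rfl, invFact_intCast, invFact_intCast]
  by_cases h : z < 0
  · simp [h, intChoose_of_neg h]
  rw [if_neg h]
  lift z to ℕ using by omega
  rw [intChoose_natCast, Int.toNat_natCast]
  by_cases h' : L < z
  · rw [if_pos (by omega), Nat.choose_eq_zero_of_lt h']; simp
  · rw [if_neg (by omega), ← Nat.cast_sub (by omega), Int.toNat_natCast,
      Nat.cast_choose ℝ (by omega : z ≤ L)]
    field_simp

theorem sum_range_eq_sum_range {a b : ℕ} (F : ℕ → ℝ) (ha : ∀ t, a < t → F t = 0)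
    (hb : ∀ t, b < t → F t = 0) :
    ∑ t ∈ Finset.range (a + 1), F t = ∑ t ∈ Finset.range (b + 1), F t := by
  wlog h : a ≤ b generalizing a b
  · exact (this hb ha (by omega)).symm
  · exact Finset.sum_subset (Finset.range_mono (by omega)) fun t _ ht => ha t (by simpa using ht)

/-- Racah's sum becomes `coupling_eq_sum` under $r=l-t$; both ranges are first changed to
$0,\dots,l$, as the terms gained or lost vanish. -/
theorem sum_altChoose_mul_intChoose (L n k l : ℕ) :
    ∑ t ∈ Finset.range (L + 1),
      altChoose L t * (intChoose L (t - (l - k)) * intChoose n (l - t)) = coupling L n k l := by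
  rw [coupling_eq_sum, sum_range_eq_sum_range (a := L) (b := l),
    sum_range_eq_sum_range (a := n) (b := l), ← Finset.sum_range_reflect]
  · refine Finset.sum_congr rfl fun t ht => ?_
    rw [Finset.mem_range] at ht
    rw [show l + 1 - 1 - t = l - t by omega, Nat.cast_sub (by omega),
      show (l : ℤ) - (l - t) = (t : ℕ) by omega, intChoose_natCast n,
      show (l - t : ℤ) - (l - k) = k - t by omega]
    ring
  · intro t ht; rw [Nat.choose_eq_zero_of_lt ht]; simp
  · intro t ht; rw [altChoose_of_neg (by omega)]; simp
  · intro t ht; rw [altChoose_of_lt (by omega)]; simp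
  · intro t ht; rw [intChoose_of_neg (k := l - t) (by omega)]; simp

theorem clebschGordan_eq_coupling {L n k l : ℕ} {M : ℤ} (hM : |M| ≤ L) (hk : k ≤ L + n)
    (hl : l ≤ L + n) (h : (l - k : ℤ) = M) {s : ℚ} (hs : 2 * s = (L + n : ℕ)) :
    clebschGordan s (s - l) L M s (s - k) =
      √((L + n + 1) * L.factorial * n.factorial * L.factorial / (2 * L + 1 + n).factorial) *
      √(binomWeight (L + n) l * ((L + M).toNat.factorial * (L - M).toNat.factorial)
        * binomWeight (L + n) k) *
      (coupling L n k l / (L.factorial ^ 2 * n.factorial)) := by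
  have hM' := abs_le.mp hM
  have hMc : (M : ℚ) = l - k := by rw [← h]; push_cast; rfl
  have hs' : 2 * s = L + n := by rw [hs]; push_cast; rfl
  have hsR : 2 * (s : ℝ) = L + n := by exact_mod_cast hs'
  have e1 : s + L - s = (L : ℕ) := by ring
  have e2 : s - L + s = (n : ℕ) := by linarith
  have e3 : -s + L + s = (L : ℕ) := by ring
  have e4 : s + L + s + 1 = (2 * L + 1 + n : ℕ) := by push_cast; linarith
  have w1 : ∀ {x : ℕ}, x ≤ L + n → s + (s - x) = (L + n - x : ℕ) := fun hx => by
    push_cast [hx]; linarith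
  have w2 : ∀ x : ℕ, s - (s - x) = (x : ℕ) := fun x => by ring
  have p1 : (L + M : ℚ) = ((L + M).toNat : ℕ) := by
    rw [← Int.cast_natCast (R := ℚ) (Int.toNat _), Int.toNat_of_nonneg (by omega)]; push_cast; rfl
  have p2 : (L - M : ℚ) = ((L - M).toNat : ℕ) := by
    rw [← Int.cast_natCast (R := ℚ) (Int.toNat _), Int.toNat_of_nonneg (by omega)]; push_cast; rfl
  rw [clebschGordan, if_pos]
  · have hsum : ∑ t ∈ Finset.range (⌊s + L - s⌋₊ + 1),
        (-1 : ℝ) ^ t * invFact t * invFact (s + L - s - t) * invFact (s - (s - l) - t)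
          * invFact (L + M - t) * invFact (s - L + (s - l) + t) * invFact (s - s - M + t) =
        coupling L n k l / (L.factorial ^ 2 * n.factorial) := by
      rw [← sum_altChoose_mul_intChoose, Finset.sum_div, e1, Nat.floor_natCast]
      refine Finset.sum_congr rfl fun t _ => ?_
      have i1 := invFact_mul_invFact L t
      have i2 := invFact_mul_invFact L (t - (l - k))
      have i3 := invFact_mul_invFact n (l - t)
      push_cast at i1 i2 i3
      rw [show s - (s - l) - t = (l - t : ℚ) by ring,
        show s - L + (s - l) + t = (n - (l - t) : ℚ) by linarith,
        show s - s - (M : ℚ) + t = t - (l - k) by rw [hMc]; ring,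
        show (L : ℚ) + M - t = L - (t - (l - k)) by rw [hMc]; ring, altChoose_natCast]
      rw [intChoose_natCast] at i1
      calc _ = (-1) ^ t * (invFact t * invFact (L - t)) *
            (invFact (t - (l - k)) * invFact (L - (t - (l - k)))) *
            (invFact (l - t) * invFact (n - (l - t))) := by ring
        _ = _ := by rw [i1, i2, i3]; field_simp
    rw [hsum, e1, e2, e3, e4, w1 hk, w1 hl, w2, w2, p1, p2, hsR]
    simp only [fact_natCast, binomWeight]
    congr 3
    ring
  · refine ⟨⟨⟨_, w1 hl⟩, ⟨_, w2 l⟩⟩, ⟨⟨_, p1⟩, ⟨_, p2⟩⟩, ⟨⟨_, w1 hk⟩, ⟨_, w2 k⟩⟩,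
      ⟨⟨_, e1⟩, ⟨_, e2⟩, ⟨_, e3⟩⟩, ?_⟩
    rw [hMc]; ring

theorem clebschGordan_eq_zero_of_ne {j₁ m₁ j₂ m₂ j m : ℚ} (h : m ≠ m₁ + m₂) :
    clebschGordan j₁ m₁ j₂ m₂ j m = 0 :=
  if_neg fun h' => h h'.2.2.2.2

/-- The normalization of the polarization operator `T_{LM}`. -/
noncomputable def polNorm (L n : ℕ) (M : ℤ) : ℝ :=
  √((2 * L + 1) * ((L + M).toNat.factorial * (L - M).toNat.factorial) /
    (L.factorial ^ 2 * n.factorial * (2 * L + 1 + n).factorial))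

theorem polarizationOp_apply (d L : ℕ) (M : ℤ) (k l : Fin d) :
    polarizationOp d L M k l =
      ((√((2 * (L : ℝ) + 1) / (2 * (spin d : ℝ) + 1)) *
        clebschGordan (spin d) (mag d l) L M (spin d) (mag d k) : ℝ) : ℂ) := by
  simp only [polarizationOp, ketBra, Matrix.smul_apply, Matrix.sum_apply, Matrix.single_apply,
    smul_eq_mul, mul_ite, mul_one, mul_zero, ite_and]
  rw [Finset.sum_eq_single k, Finset.sum_eq_single l]
  · simp
  · intro b _ hb; simp [hb]
  · simp
  · intro b _ hb; simp [hb]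
  · simp

/-- The entry of the polarization operator `T_{LM}` in dimension `d = L + n + 1`. -/
theorem polarizationOp_apply_eq_coupling {L n : ℕ} {M : ℤ} (hM : |M| ≤ L)
    {d : ℕ} (hd : d = L + n + 1) (k l : Fin d) :
    polarizationOp d L M k l =
      ((if ((l : ℕ) - (k : ℕ) : ℤ) = M then
        polNorm L n M * √(binomWeight (L + n) k * binomWeight (L + n) l) * coupling L n k l
        else 0 : ℝ) : ℂ) := by
  subst hd
  have hs : 2 * spin (L + n + 1) = (L + n : ℕ) := by simp [spin]; ring
  have hsR : 2 * (spin (L + n + 1) : ℝ) = L + n := by exact_mod_cast hs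
  rw [polarizationOp_apply, mag, mag]
  congr 1
  split_ifs with h
  · rw [clebschGordan_eq_coupling hM (by omega) (by omega) h hs, hsR, polNorm]
    have hw := binomWeight_pos (L + n) k
    have hw' := binomWeight_pos (L + n) l
    -- The rational factor $1/(L!^2\,n!)$ is put under a root so that all the radicals merge.
    rw [div_eq_inv_mul (coupling _ _ _ _),
      ← Real.sqrt_sq (by positivity : (0 : ℝ) ≤ ((L.factorial : ℝ) ^ 2 * n.factorial)⁻¹),
      ← mul_assoc, ← mul_assoc, ← Real.sqrt_mul (by positivity), ← Real.sqrt_mul (by positivity),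
      ← Real.sqrt_mul (by positivity), ← Real.sqrt_mul (by positivity)]
    congr 2
    field_simp
  · rw [clebschGordan_eq_zero_of_ne, mul_zero]
    intro h'
    apply h
    have : ((l : ℕ) - (k : ℕ) : ℚ) = M := by linarith
    exact_mod_cast this

/-! ### Orthonormality and completeness of the polarization operators -/

theorem polNorm_sq_mul_pairing (L n : ℕ) (M : ℤ) (h : |M| ≤ L) :
    polNorm L n M ^ 2 *
      pairing (L + n) (fun m => if m = M then 1 else 0) (coupling L n) (coupling L n) = 1 := by
  rw [polNorm, Real.sq_sqrt (by positivity), div_mul_eq_mul_div, pairing_coupling_indicator L n M h]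
  exact div_self (by positivity)

/-- The entries are real, so no conjugation is needed. Different $M$ have disjoint supports; for
equal $M$ the two square roots multiply to the weight of `pairing`. -/
theorem sum_polarizationOp_mul {d L L' : ℕ} {M M' : ℤ} (hL : L < d) (hL' : L' < d)
    (hM : |M| ≤ L) (hM' : |M'| ≤ L') :
    ∑ k : Fin d, ∑ l : Fin d, polarizationOp d L M k l * polarizationOp d L' M' k l =
      if L = L' ∧ M = M' then 1 else 0 := by
  obtain ⟨n, hn⟩ := Nat.exists_eq_add_of_lt hL
  obtain ⟨n', hn'⟩ := Nat.exists_eq_add_of_lt hL'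
  simp only [polarizationOp_apply_eq_coupling hM hn, polarizationOp_apply_eq_coupling hM' hn']
  by_cases h : M = M'
  · subst h
    have key : ∑ k : Fin d, ∑ l : Fin d,
        ((if ((l : ℕ) - (k : ℕ) : ℤ) = M then
          polNorm L n M * √(binomWeight (L + n) k * binomWeight (L + n) l) * coupling L n k l
          else 0) *
        (if ((l : ℕ) - (k : ℕ) : ℤ) = M then
          polNorm L' n' M * √(binomWeight (L' + n') k * binomWeight (L' + n') l) *
            coupling L' n' k l
          else 0)) = polNorm L n M * polNorm L' n' M *
          pairing (L + n) (fun m => if m = M then 1 else 0) (coupling L n) (coupling L' n') := by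
      subst hn
      have e : L' + n' = L + n := by omega
      simp only [pairing, Finset.mul_sum, Finset.sum_range, e]
      refine Finset.sum_congr rfl fun k _ => Finset.sum_congr rfl fun l _ => ?_
      split_ifs
      · have hw := mul_pos (binomWeight_pos (L + n) k) (binomWeight_pos (L + n) l)
        have := Real.mul_self_sqrt hw.le
        linear_combination polNorm L n M * coupling L n k l *
          (polNorm L' n' M * coupling L' n' k l) * this
      · simp
    have key' := congrArg (fun x : ℝ => (x : ℂ)) key
    simp only [Complex.ofReal_sum, Complex.ofReal_mul _ (ite _ _ _)] at key'
    rw [key']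
    by_cases hLL : L = L'
    · subst hLL
      obtain rfl : n = n' := by omega
      rw [if_pos ⟨rfl, rfl⟩, ← sq, polNorm_sq_mul_pairing L n M hM, Complex.ofReal_one]
    · rw [if_neg fun h => hLL h.1, pairing_coupling_of_ne (by omega) hLL, mul_zero,
        Complex.ofReal_zero]
  · rw [if_neg fun h' => h h'.2]
    refine Finset.sum_eq_zero fun k _ => Finset.sum_eq_zero fun l _ => ?_
    split_ifs with h1 h2
    · exact absurd (h1.symm.trans h2) h
    · simp
    · simp
    · simp

/-- The pairs `(L, M)` with `L < d` and `-L ≤ M ≤ L`. -/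
noncomputable def polIndex (d : ℕ) : Finset (Σ _ : ℕ, ℤ) :=
  (Finset.range d).sigma fun L => Finset.Icc (-(L : ℤ)) L

theorem card_polIndex (d : ℕ) : (polIndex d).card = d * d := by
  rw [polIndex, Finset.card_sigma]
  induction d with
  | zero => rfl
  | succ d ih =>
    rw [Finset.sum_range_succ, ih, Int.card_Icc, show ((d : ℤ) + 1 - -d).toNat = 2 * d + 1 by omega]
    ring

/-- The polarization operators are a complete orthonormal system. -/
theorem sum_polarizationOp_mul_polarizationOp (d : ℕ) (i j k l : Fin d) :
    ∑ L ∈ Finset.range d, ∑ M ∈ Finset.Icc (-(L : ℤ)) L,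
      polarizationOp d L M i j * polarizationOp d L M k l = if i = k ∧ j = l then 1 else 0 := by
  let A : Matrix (polIndex d) (Fin d × Fin d) ℂ :=
    fun x p => polarizationOp d x.1.1 x.1.2 p.1 p.2
  have hA : A * A.transpose = 1 := by
    ext ⟨⟨L, M⟩, hx⟩ ⟨⟨L', M'⟩, hy⟩
    simp only [polIndex, Finset.mem_sigma, Finset.mem_range, Finset.mem_Icc] at hx hy
    rw [Matrix.mul_apply, Fintype.sum_prod_type, Matrix.one_apply]
    refine (sum_polarizationOp_mul hx.1 hy.1 (abs_le.mpr hx.2) (abs_le.mpr hy.2)).trans ?_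
    simp
  -- The index sets have equal size $\sum_{L<d}(2L+1)=d^2$, so orthonormal rows give orthonormal
  -- columns.
  have hA' : A.transpose * A = 1 :=
    (Matrix.mul_eq_one_comm_of_card_eq _ _ _ (by simp [card_polIndex])).mp hA
  have h := congrFun (congrFun hA' (i, j)) (k, l)
  rw [Matrix.mul_apply, Matrix.one_apply] at h
  simp only [Prod.mk.injEq] at h
  rw [← h, ← Finset.sum_sigma (Finset.range d) (fun L => Finset.Icc (-(L : ℤ)) L)
    (fun x => polarizationOp d x.1 x.2 i j * polarizationOp d x.1 x.2 k l)]
  exact (Finset.sum_coe_sort (polIndex d) fun x =>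
    polarizationOp d x.1 x.2 i j * polarizationOp d x.1 x.2 k l).symm

/-! ### The operator $T_{00}$ and the entries of $T$ -/

theorem coupling_zero_left (n k l : ℕ) :
    coupling 0 n k l = if k = l then (n.choose k : ℝ) else 0 := by
  have h : ∀ z : ℤ, intChoose 0 z = if z = 0 then 1 else 0 := fun z => by
    rcases lt_trichotomy z 0 with h | rfl | h
    · rw [intChoose_of_neg h, if_neg h.ne]
    · simp [intChoose]
    · rw [intChoose_of_lt (by simpa using h), if_neg h.ne']
  rw [← sum_altChoose_mul_intChoose]
  simp only [zero_add, Finset.sum_range_one, h]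
  rw [altChoose_natCast]
  by_cases hkl : k = l
  · subst hkl; simp [intChoose_natCast]
  · rw [if_neg (by omega : ¬ ((0 : ℕ) - (l - k) : ℤ) = 0), if_neg hkl]; simp

/-- For $L=0$ the polynomial is $(1+xy)^n$, and $k!(n-k)!\binom nk=n!$ does not depend on $k$. -/
theorem polarizationOp_zero_zero (d : ℕ) (k l : Fin d) :
    polarizationOp d 0 0 k l = if k = l then ((1 / √d : ℝ) : ℂ) else 0 := by
  obtain ⟨n, rfl⟩ : ∃ n, d = 0 + n + 1 := ⟨d - 1, by have := k.2; omega⟩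
  rw [polarizationOp_apply_eq_coupling (by simp) rfl, coupling_zero_left]
  by_cases h : k = l
  · subst h
    rw [if_pos (by simp), if_pos rfl, if_pos rfl, ← sq, Real.sqrt_sq (binomWeight_pos _ _).le,
      mul_assoc, show binomWeight (0 + n) k * n.choose k = n.factorial by
        simpa using binomWeight_mul_choose (L := n) (k := k) (by omega), polNorm]
    congr 1
    rw [← Real.sqrt_sq (by positivity : (0 : ℝ) ≤ n.factorial), ← Real.sqrt_mul (by positivity),
      one_div, ← Real.sqrt_inv]
    congr 1
    rw [show 2 * 0 + 1 + n = n + 1 by omega, Nat.factorial_succ]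
    push_cast
    simp
    field_simp
  · rw [if_neg (by omega), if_neg h, Complex.ofReal_zero]

theorem sum_polarizationOp_kronecker_apply (d : ℕ) (p q : Fin d × Fin d) :
    (∑ L ∈ Finset.range d, ∑ M ∈ Finset.Icc (-(L : ℤ)) L,
      polarizationOp d L M ⊗ₖ polarizationOp d L M) p q =
      if p.1 = p.2 ∧ q.1 = q.2 then 1 else 0 := by
  simp only [Matrix.sum_apply]
  exact sum_polarizationOp_mul_polarizationOp d p.1 q.1 p.2 q.2

theorem polarizationOp_zero_kronecker (d : ℕ) :
    polarizationOp d 0 0 ⊗ₖ polarizationOp d 0 0 =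
      (1 / (d : ℂ)) • ((1 : Matrix (Fin d) (Fin d) ℂ) ⊗ₖ (1 : Matrix (Fin d) (Fin d) ℂ)) := by
  ext p q
  rw [Matrix.kronecker_apply, Matrix.smul_apply, Matrix.kronecker_apply, polarizationOp_zero_zero,
    polarizationOp_zero_zero, Matrix.one_apply, Matrix.one_apply]
  have h : ((1 / √d : ℝ) : ℂ) * ((1 / √d : ℝ) : ℂ) = 1 / d := by
    rw [← Complex.ofReal_mul, div_mul_div_comm, Real.mul_self_sqrt (Nat.cast_nonneg d)]
    push_cast; ring
  split_ifs <;> simp_all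

theorem sum_polarizationOp_kronecker {d : ℕ} (hd : 1 ≤ d) :
    ∑ L ∈ Finset.range d, ∑ M ∈ Finset.Icc (-(L : ℤ)) L,
      polarizationOp d L M ⊗ₖ polarizationOp d L M =
      (1 / (d : ℂ)) • ((1 : Matrix (Fin d) (Fin d) ℂ) ⊗ₖ (1 : Matrix (Fin d) (Fin d) ℂ))
        + opT d := by
  obtain ⟨d, rfl⟩ := Nat.exists_eq_add_of_le' hd
  rw [← polarizationOp_zero_kronecker, opT, Finset.sum_range_succ', Finset.sum_range_succ']
  have h0 : Finset.filter (fun M => ((0 : ℕ), M) ≠ ((0, 0) : ℕ × ℤ))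
      (Finset.Icc (-((0 : ℕ) : ℤ)) (0 : ℕ)) = ∅ := by
    simp
  rw [h0, Finset.sum_empty, add_zero]
  refine (add_comm _ _).trans ?_
  congr 1
  · simp
  · refine Finset.sum_congr rfl fun L _ => ?_
    rw [Finset.filter_true_of_mem]
    simp

/-- The entries of `T`. -/
theorem opT_apply {d : ℕ} (hd : 1 ≤ d) (p q : Fin d × Fin d) :
    opT d p q = (if p.1 = p.2 ∧ q.1 = q.2 then 1 else 0) - (if p = q then 1 / (d : ℂ) else 0) := by
  have h := congrFun (congrFun (sum_polarizationOp_kronecker hd) p) q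
  rw [sum_polarizationOp_kronecker_apply] at h
  rw [h, Matrix.add_apply, Matrix.one_kronecker_one, Matrix.smul_apply, Matrix.one_apply]
  split_ifs <;> simp

/-! ### The Bell state -/

theorem bellKet_apply (d : ℕ) (p : Fin d × Fin d) :
    bellKet d p = if p.1 = p.2 then ((1 / √d : ℝ) : ℂ) else 0 := by
  rw [bellKet, Pi.smul_apply, Finset.sum_apply, Finset.sum_eq_single p.1]
  · by_cases h : p.1 = p.2
    · simp [h]
    · simp [h, Ne.symm h]
  · intro j _ hj; simp [Pi.single_apply, hj.symm]
  · simp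

theorem bellState_apply (d : ℕ) (p q : Fin d × Fin d) :
    bellState d p q = if p.1 = p.2 ∧ q.1 = q.2 then 1 / (d : ℂ) else 0 := by
  have h : ((1 / √d : ℝ) : ℂ) * ((1 / √d : ℝ) : ℂ) = 1 / d := by
    rw [← Complex.ofReal_mul, div_mul_div_comm, Real.mul_self_sqrt (Nat.cast_nonneg d)]
    push_cast; ring
  rw [bellState, Matrix.vecMulVec_apply, Pi.star_apply, bellKet_apply, bellKet_apply]
  by_cases h1 : p.1 = p.2 <;> by_cases h2 : q.1 = q.2 <;>
    simp only [h1, h2, if_true, if_false, and_true, and_false, star_zero, mul_zero, zero_mul,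
      Complex.star_def, Complex.conj_ofReal, h]

theorem bellState_eq_sum (d : ℕ) :
    bellState d = (1 / (d : ℂ)) • ∑ L ∈ Finset.range d, ∑ M ∈ Finset.Icc (-(L : ℤ)) L,
      polarizationOp d L M ⊗ₖ polarizationOp d L M := by
  ext p q
  rw [Matrix.smul_apply, sum_polarizationOp_kronecker_apply, bellState_apply]
  simp

/-! ### The generalized Gell-Mann matrices -/

/-- Induction on $d$ with $i\le j$. If $j$ is an old index, the new term $2/(d(d+1))$ telescopes as
$2/d-2/(d+1)$; if $j$ is the new index, only $l=j$ contributes. -/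
theorem sum_gellMannDiag_coeff {d i j : ℕ} (hi : i < d) (hj : j < d) :
    ∑ l ∈ Finset.Icc 1 (d - 1), (2 / ((l : ℂ) * (l + 1))) *
      ((if i < l then 1 else if i = l then -(l : ℂ) else 0) *
        (if j < l then 1 else if j = l then -(l : ℂ) else 0)) =
      2 * ((if i = j then 1 else 0) - 1 / (d : ℂ)) := by
  wlog hij : i ≤ j generalizing i j
  · have := this hj hi (by omega)
    simp only [eq_comm (a := i) (b := j)]
    rw [← this]
    exact Finset.sum_congr rfl fun l _ => by rw [mul_comm (ite (i < l) _ _)]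
  induction d with
  | zero => omega
  | succ d ih =>
    have hd1 : (d : ℂ) + 1 ≠ 0 := Nat.cast_add_one_ne_zero d
    rcases Nat.lt_succ_iff_lt_or_eq.mp hj with hjd | rfl
    · have hd0 : (d : ℂ) ≠ 0 := Nat.cast_ne_zero.mpr (by omega)
      have e : d + 1 - 1 = d - 1 + 1 := by omega
      rw [e, Finset.sum_Icc_succ_top (by omega), ih (by omega) hjd, Nat.sub_add_cancel (by omega),
        if_pos (by omega : i < d), if_pos hjd]
      push_cast
      field_simp
      ring
    · have hz : ∀ l ∈ Finset.Icc 1 (j - 1), (2 / ((l : ℂ) * (l + 1))) *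
          ((if i < l then 1 else if i = l then -(l : ℂ) else 0) *
          (if j < l then 1 else if j = l then -(l : ℂ) else 0)) = 0 := fun l hl => by
        rw [Finset.mem_Icc] at hl
        rw [if_neg (by omega : ¬ j < l), if_neg (by omega : ¬ j = l), mul_zero, mul_zero]
      rcases Nat.eq_zero_or_pos j with rfl | hpos
      · obtain rfl : i = 0 := by omega
        simp
      · have hj0 : (j : ℂ) ≠ 0 := Nat.cast_ne_zero.mpr hpos.ne'
        rw [show j + 1 - 1 = j - 1 + 1 by omega, Finset.sum_Icc_succ_top (by omega),
          Finset.sum_eq_zero hz, Nat.sub_add_cancel hpos]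
        rcases hij.lt_or_eq with h | rfl
        · rw [if_pos h, if_neg h.ne]
          simp only [lt_irrefl, if_true, if_false]
          push_cast
          field_simp
          ring
        · simp only [lt_irrefl, if_true, if_false]
          push_cast
          field_simp
          ring

theorem sum_gellMannDiag_kronecker_apply {d : ℕ} (p q : Fin d × Fin d) :
    (∑ l ∈ Finset.Icc 1 (d - 1), gellMannDiag d l ⊗ₖ gellMannDiag d l) p q =
      if p = q then 2 * ((if p.1 = p.2 then 1 else 0) - 1 / (d : ℂ)) else 0 := by
  rw [Matrix.sum_apply]
  by_cases h : p = q
  · subst h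
    rw [if_pos rfl]
    simp only [← Fin.val_inj]
    rw [← sum_gellMannDiag_coeff p.1.2 p.2.2]
    refine Finset.sum_congr rfl fun l _ => ?_
    have hs : ((√(2 / ((l : ℝ) * (l + 1))) : ℝ) : ℂ) * ((√(2 / ((l : ℝ) * (l + 1))) : ℝ) : ℂ) =
        2 / ((l : ℂ) * (l + 1)) := by
      rw [← Complex.ofReal_mul, Real.mul_self_sqrt (by positivity)]
      push_cast; rfl
    rw [Matrix.kronecker_apply, gellMannDiag, Matrix.smul_apply, Matrix.smul_apply,
      Matrix.diagonal_apply_eq, Matrix.diagonal_apply_eq, smul_eq_mul, smul_eq_mul, ← hs]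
    ring
  · rw [if_neg h]
    refine Finset.sum_eq_zero fun l _ => ?_
    rw [Matrix.kronecker_apply, gellMannDiag, Matrix.smul_apply, Matrix.smul_apply]
    by_cases h1 : p.1 = q.1
    · rw [Matrix.diagonal_apply_ne _ fun h2 => h (Prod.ext h1 h2), smul_zero, mul_zero]
    · rw [Matrix.diagonal_apply_ne _ h1, smul_zero, zero_mul]

/-- With $a=|j\rangle\langle k|$ and $b=|k\rangle\langle j|$ the left side is
$(a+b)^{\otimes2}+(a-b)^{\otimes2}$, since $(-i)^2=-1$; cross terms cancel. -/
theorem gellMannSymm_kronecker_sub_gellMannAnti_kronecker {d : ℕ} (j k : Fin d) :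
    gellMannSymm j k ⊗ₖ gellMannSymm j k - gellMannAnti j k ⊗ₖ gellMannAnti j k =
      (2 : ℂ) • (ketBra j k ⊗ₖ ketBra j k + ketBra k j ⊗ₖ ketBra k j) := by
  ext ⟨a, b⟩ ⟨c, e⟩
  simp only [gellMannSymm, gellMannAnti, Matrix.sub_apply, Matrix.add_apply, Matrix.smul_apply,
    Matrix.kroneckerMap_apply, smul_eq_mul]
  linear_combination -(ketBra j k a c - ketBra k j a c) *
    (ketBra j k b e - ketBra k j b e) * Complex.I_mul_I

theorem sum_ketBra_kronecker_apply {d : ℕ} (P : Fin d → Fin d → Prop) [∀ j k, Decidable (P j k)]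
    (p q : Fin d × Fin d) :
    (∑ j : Fin d, ∑ k : Fin d, if P j k then ketBra j k ⊗ₖ ketBra j k else 0) p q =
      if P p.1 q.1 ∧ p.1 = p.2 ∧ q.1 = q.2 then 1 else 0 := by
  simp only [Matrix.sum_apply]
  rw [Finset.sum_eq_single p.1, Finset.sum_eq_single q.1]
  · by_cases h : P p.1 q.1
    · simp [h, ketBra, Matrix.single_apply]
    · simp [h]
  · intro k _ hk
    split_ifs
    · simp [ketBra, Matrix.single_apply, hk]
    · rfl
  · simp
  · intro j _ hj
    refine Finset.sum_eq_zero fun k _ => ?_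
    split_ifs
    · simp [ketBra, Matrix.single_apply, hj]
    · rfl
  · simp

theorem opLambda_eq_smul_opT {d : ℕ} (hd : 1 ≤ d) : opLambda d = (2 : ℂ) • opT d := by
  have h : (∑ j : Fin d, ∑ k ∈ Finset.univ.filter (fun k => j < k),
        gellMannSymm j k ⊗ₖ gellMannSymm j k)
      - (∑ j : Fin d, ∑ k ∈ Finset.univ.filter (fun k => j < k),
        gellMannAnti j k ⊗ₖ gellMannAnti j k) =
      (2 : ℂ) • ∑ j : Fin d, ∑ k : Fin d, if j ≠ k then ketBra j k ⊗ₖ ketBra j k else 0 := by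
    -- Ordered pairs $j\ne k$ split into $j<k$ and, with names exchanged, $k<j$.
    have h1 : ∑ j : Fin d, ∑ k : Fin d, (if j ≠ k then ketBra j k ⊗ₖ ketBra j k else 0) =
        ∑ j : Fin d, ∑ k : Fin d, (if j < k then ketBra j k ⊗ₖ ketBra j k else 0) +
        ∑ j : Fin d, ∑ k : Fin d, (if j < k then ketBra k j ⊗ₖ ketBra k j else 0) := by
      rw [Finset.sum_comm (f := fun j k => if j < k then ketBra k j ⊗ₖ ketBra k j else 0)]
      simp only [← Finset.sum_add_distrib]
      refine Finset.sum_congr rfl fun j _ => Finset.sum_congr rfl fun k _ => ?_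
      rcases lt_trichotomy j k with h | rfl | h
      · simp [h, h.ne, h.not_gt]
      · simp
      · simp [h, h.ne', h.not_gt]
    rw [h1]
    simp only [Finset.sum_filter, ← Finset.sum_sub_distrib, ← Finset.sum_add_distrib,
      Finset.smul_sum]
    refine Finset.sum_congr rfl fun j _ => Finset.sum_congr rfl fun k _ => ?_
    split_ifs
    · exact gellMannSymm_kronecker_sub_gellMannAnti_kronecker j k
    · simp
  ext p q
  rw [opLambda, h, Matrix.add_apply, Matrix.smul_apply, Matrix.smul_apply,
    sum_gellMannDiag_kronecker_apply, sum_ketBra_kronecker_apply, opT_apply hd]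
  obtain ⟨a, b⟩ := p
  obtain ⟨c, e⟩ := q
  simp only [Prod.mk.injEq, smul_eq_mul]
  by_cases h1 : a = b <;> by_cases h2 : c = e <;> by_cases h3 : a = c <;> by_cases h4 : b = e <;>
    simp_all

/-! ### The Weyl operators -/

theorem weylOp_apply (d n m : ℕ) (j k : Fin d) :
    weylOp d n m j k = if ((j : ℕ) + m) % d = k then
      Complex.exp (2 * Real.pi * Complex.I / d * ((j : ℕ) * n)) else 0 := by
  rw [weylOp, Matrix.sum_apply, Finset.sum_eq_single j]
  · simp [ketBra, Matrix.single_apply, Fin.ext_iff]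
  · intro b _ hb; simp [ketBra, hb]
  · simp

theorem weylOp_zero_zero (d : ℕ) : weylOp d 0 0 = 1 := by
  ext j k
  rw [weylOp_apply, Matrix.one_apply, add_zero, Nat.mod_eq_of_lt j.2]
  simp [Fin.ext_iff]

theorem exp_two_pi_mul_sub_mod {d l : ℕ} (hl : l < d) (b : ℕ) :
    Complex.exp (2 * Real.pi * Complex.I / d * (b * ((d - l) % d : ℕ))) =
      Complex.exp (-(2 * Real.pi * Complex.I / d * (b * l))) := by
  have hd : (d : ℂ) ≠ 0 := Nat.cast_ne_zero.mpr (by omega)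
  rcases Nat.eq_zero_or_pos l with rfl | h
  · simp
  · rw [Nat.mod_eq_of_lt (by omega), Nat.cast_sub hl.le, Complex.exp_eq_exp_iff_exists_int]
    -- Replacing $d-l$ by $-l$ changes the exponent by $2\pi i\,b$.
    refine ⟨b, ?_⟩
    push_cast
    field_simp
    ring

/-- A geometric sum in $\zeta=e^{2\pi i(a-b)/d}$, where $\zeta^d=1$ and, as $|a-b|<d$, $\zeta=1$
only for $a=b$. -/
theorem sum_exp_mul_exp_sub_mod {d : ℕ} (a b : Fin d) :
    ∑ l ∈ Finset.range d, Complex.exp (2 * Real.pi * Complex.I / d * ((a : ℕ) * l)) *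
      Complex.exp (2 * Real.pi * Complex.I / d * ((b : ℕ) * ((d - l) % d : ℕ))) =
      if a = b then (d : ℂ) else 0 := by
  have hd0 : d ≠ 0 := a.pos.ne'
  have hd : (d : ℂ) ≠ 0 := Nat.cast_ne_zero.mpr hd0
  set ζ : ℂ := Complex.exp (2 * Real.pi * Complex.I / d * ((a : ℕ) - (b : ℕ))) with hζ
  have h1 : ∀ l ∈ Finset.range d, Complex.exp (2 * Real.pi * Complex.I / d * ((a : ℕ) * l)) *
      Complex.exp (2 * Real.pi * Complex.I / d * ((b : ℕ) * ((d - l) % d : ℕ))) = ζ ^ l := by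
    intro l hl
    rw [exp_two_pi_mul_sub_mod (Finset.mem_range.mp hl), ← Complex.exp_add, hζ, ← Complex.exp_nat_mul]
    congr 1
    ring
  rw [Finset.sum_congr rfl h1]
  split_ifs with hab
  · subst hab; simp [hζ]
  · have hζ1 : ζ ≠ 1 := by
      intro h
      rw [hζ, Complex.exp_eq_one_iff] at h
      obtain ⟨n, hn⟩ := h
      have hpi : (2 * Real.pi * Complex.I : ℂ) ≠ 0 := Complex.two_pi_I_ne_zero
      have h2 : ((a : ℕ) - (b : ℕ) : ℂ) = n * d := by
        apply mul_left_cancel₀ hpi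
        rw [← mul_assoc, mul_comm _ (n : ℂ), ← hn]
        field_simp
      have h3 : ((a : ℕ) - (b : ℕ) : ℤ) = n * d := by exact_mod_cast h2
      have h4 := Int.eq_zero_of_abs_lt_dvd (Dvd.intro_left n h3.symm)
        (abs_lt.mpr ⟨by omega, by omega⟩)
      omega
    have h5 : ζ ^ d = 1 := by
      rw [hζ, ← Complex.exp_nat_mul, Complex.exp_eq_one_iff]
      refine ⟨(a : ℕ) - (b : ℕ), ?_⟩
      push_cast
      field_simp
    have h6 := mul_neg_geom_sum ζ d
    rw [h5, sub_self] at h6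
    exact (mul_eq_zero.mp h6).resolve_left (sub_ne_zero.mpr hζ1.symm)

theorem sum_ite_add_mod_eq {d : ℕ} (a c : Fin d) :
    ∑ m ∈ Finset.range d, (if ((a : ℕ) + m) % d = c then (1 : ℂ) else 0) = 1 := by
  have ha := a.2
  have hc := c.2
  -- The only shift taking $a$ to $c$ is $c-a$ modulo $d$; adding $d$ avoids truncated subtraction.
  rw [Finset.sum_eq_single ((c + d - a) % d)]
  · rw [if_pos]
    rw [Nat.add_mod_mod, show (a : ℕ) + (c + d - a) = c + d by omega, Nat.add_mod_right,
      Nat.mod_eq_of_lt hc]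
  · intro m hm hne
    rw [Finset.mem_range] at hm
    refine if_neg fun h => hne ?_
    rw [← h]
    rcases lt_or_ge ((a : ℕ) + m) d with h1 | h1
    · rw [Nat.mod_eq_of_lt h1, show (a : ℕ) + m + d - a = m + d by omega, Nat.add_mod_right,
        Nat.mod_eq_of_lt hm]
    · rw [Nat.mod_eq_sub_mod h1, Nat.mod_eq_of_lt (by omega : (a : ℕ) + m - d < d),
        show (a : ℕ) + m - d + d - a = m by omega, Nat.mod_eq_of_lt hm]
  · intro h
    exact absurd (Finset.mem_range.mpr (Nat.mod_lt _ a.pos)) h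

/-- The sum factors: the phases, summed over $l$, force `p.1 = p.2`; then the shifts, summed over
$m$, force `q.1 = q.2`. -/
theorem sum_weylOp_kronecker_apply {d : ℕ} (p q : Fin d × Fin d) :
    (∑ l ∈ Finset.range d, ∑ m ∈ Finset.range d,
      weylOp d l m ⊗ₖ weylOp d ((d - l) % d) m) p q =
      if p.1 = p.2 ∧ q.1 = q.2 then (d : ℂ) else 0 := by
  simp only [Matrix.sum_apply]
  have h : ∀ l m, (weylOp d l m ⊗ₖ weylOp d ((d - l) % d) m) p q =
      (Complex.exp (2 * Real.pi * Complex.I / d * ((p.1 : ℕ) * l)) *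
        Complex.exp (2 * Real.pi * Complex.I / d * ((p.2 : ℕ) * ((d - l) % d : ℕ)))) *
      ((if ((p.1 : ℕ) + m) % d = q.1 then (1 : ℂ) else 0) *
        (if ((p.2 : ℕ) + m) % d = q.2 then (1 : ℂ) else 0)) := fun l m => by
    rw [Matrix.kronecker_apply, weylOp_apply, weylOp_apply]
    split_ifs <;> simp
  simp only [h, ← Finset.mul_sum]
  rw [← Finset.sum_mul, sum_exp_mul_exp_sub_mod]
  by_cases h1 : p.1 = p.2
  · rw [if_pos h1, ← h1]
    by_cases h2 : q.1 = q.2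
    · rw [← h2, if_pos ⟨rfl, rfl⟩, Finset.sum_congr rfl fun m _ =>
        (by simp : (if ((p.1 : ℕ) + m) % d = q.1 then (1 : ℂ) else 0) *
          (if ((p.1 : ℕ) + m) % d = q.1 then (1 : ℂ) else 0) =
          if ((p.1 : ℕ) + m) % d = q.1 then (1 : ℂ) else 0),
        sum_ite_add_mod_eq, mul_one]
    · rw [if_neg fun h => h2 h.2, Finset.sum_eq_zero, mul_zero]
      intro m _
      split_ifs with h3 h4
      · exact absurd (Fin.ext (h3.symm.trans h4)) h2
      · simp
      · simp
      · simp
  · rw [if_neg h1, if_neg fun h => h1 h.1, zero_mul]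

theorem sum_weylOp_kronecker {d : ℕ} (hd : 1 ≤ d) :
    ∑ l ∈ Finset.range d, ∑ m ∈ Finset.range d, weylOp d l m ⊗ₖ weylOp d ((d - l) % d) m =
      1 + opU d := by
  have h : ∀ f : ℕ → ℕ → Matrix (Fin d × Fin d) (Fin d × Fin d) ℂ,
      ∑ l ∈ Finset.range d, ∑ m ∈ Finset.range d, f l m =
      f 0 0 + ∑ l ∈ Finset.range d, ∑ m ∈ (Finset.range d).filter (fun m => (l, m) ≠ (0, 0)),
        f l m := fun f => by
    have h0 : f 0 0 = ∑ l ∈ Finset.range d, ∑ m ∈ Finset.range d,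
        if l = 0 then if m = 0 then f l m else 0 else 0 := by
      rw [Finset.sum_eq_single_of_mem 0 (Finset.mem_range.mpr hd) fun l _ hl => by simp [hl],
        Finset.sum_eq_single_of_mem 0 (Finset.mem_range.mpr hd) fun m _ hm => by simp [hm]]
      simp
    rw [h0]
    simp only [Finset.sum_filter, ← Finset.sum_add_distrib]
    refine Finset.sum_congr rfl fun l _ => Finset.sum_congr rfl fun m _ => ?_
    by_cases hl : l = 0 <;> by_cases hm : m = 0 <;> simp [hl, hm]
  rw [h, opU, Nat.sub_zero, Nat.mod_self, weylOp_zero_zero, Matrix.one_kronecker_one]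

theorem opT_eq_smul_opU {d : ℕ} (hd : 1 ≤ d) : opT d = (1 / (d : ℂ)) • opU d := by
  have hd0 : (d : ℂ) ≠ 0 := Nat.cast_ne_zero.mpr (by omega)
  ext p q
  have h := congrFun (congrFun (sum_weylOp_kronecker hd) p) q
  rw [sum_weylOp_kronecker_apply, Matrix.add_apply, Matrix.one_apply] at h
  rw [Matrix.smul_apply, ← sub_eq_iff_eq_add'.mpr h, opT_apply hd]
  split_ifs <;> simp [hd0, mul_sub]

end Qudit

theorem mainTheorem8 (d : ℕ) (hd : 1 ≤ d) :
    (Qudit.bellState d =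
        (1 / (d : ℂ)) • ∑ L ∈ Finset.range d, ∑ M ∈ Finset.Icc (-(L : ℤ)) L,
          Qudit.polarizationOp d L M ⊗ₖ Qudit.polarizationOp d L M) ∧
    (Qudit.bellState d =
        (1 / (d : ℂ) ^ 2) • ((1 : Matrix (Fin d) (Fin d) ℂ) ⊗ₖ (1 : Matrix (Fin d) (Fin d) ℂ))
          + (1 / (d : ℂ)) • Qudit.opT d) ∧
    (∀ α : ℝ, Qudit.isotropicState d α =
        (1 / (d : ℂ) ^ 2) • ((1 : Matrix (Fin d) (Fin d) ℂ) ⊗ₖ (1 : Matrix (Fin d) (Fin d) ℂ))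
          + ((α : ℂ) / (d : ℂ)) • Qudit.opT d) ∧
    Qudit.opLambda d = (2 : ℂ) • Qudit.opT d ∧
    Qudit.opT d = (1 / (d : ℂ)) • Qudit.opU d := by
  have hd0 : (d : ℂ) ≠ 0 := Nat.cast_ne_zero.mpr (by omega)
  have hbell : Qudit.bellState d =
      (1 / (d : ℂ) ^ 2) • ((1 : Matrix (Fin d) (Fin d) ℂ) ⊗ₖ (1 : Matrix (Fin d) (Fin d) ℂ))
        + (1 / (d : ℂ)) • Qudit.opT d := by
    rw [Qudit.bellState_eq_sum, Qudit.sum_polarizationOp_kronecker hd, smul_add, smul_smul,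
      div_mul_div_comm, one_mul, sq]
  refine ⟨Qudit.bellState_eq_sum d, hbell, fun α => ?_, Qudit.opLambda_eq_smul_opT hd,
    Qudit.opT_eq_smul_opU hd⟩
  rw [Qudit.isotropicState, hbell, Matrix.one_kronecker_one]
  -- The coefficients of the identity, $\alpha/d^2$ and $(1-\alpha)/d^2$, add up to $1/d^2$.
  module
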